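/- Let $A$ be a semisimple (i.e. with zero Jacobson radical) complex unital Banach algebra with unit $\mathbf 1$. Let $G_{\mathbf 1}(A)$ be the connected component of $\mathbf 1$ in the group of invertible elements of $A$. For $x\in A$ let $\sigma(x)$ denote the spectrum of $x$, let $\sigma'(x)=\sigma(x)\setminus\{0\}$, and let $\operatorname{orb}(x)=\{wxw^{-1} : w\in G_{\mathbf 1}(A)\}$; for $x,y\in A$ write $x\circ y=x+y-xy$. Let $a,b\in A$. Then the statement that every element of $\operatorname{orb}(a)$ commutes with every element of $\operatorname{orb}(b)$ is equivalent to each one of the following four conditions: (i) $\displaystyle\bigcup_{r\in\operatorname{orb}(b)}\sigma'(ar)\neq\mathbb C\setminus\{0\}$; (ii) $\displaystyle\bigcup_{r\in\operatorname{orb}(b)}\sigma'(r+a)\neq\mathbb C\setminus\{0\}$; (iii) $\displaystyle\bigcup_{r\in\operatorname{orb}(b)}\sigma'(r-a)\neq\mathbb C\setminus\{0\}$; (iv) $\displaystyle\bigcup_{r\in\operatorname{orb}(b)}\bigl(\sigma'(a\circ r)\setminus\{1\}\bigr)\neq\mathbb C\setminus\{0,1\}$. -/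

import Mathlib

/-- The principal component `G_𝟙(A)`: the connected component of `1` in the group of invertible
elements of `A`. (For a Banach algebra, the topology on `Aˣ` is the one induced by the norm.) -/
def principalComponent (A : Type*) [NormedRing A] : Subgroup Aˣ :=
  Subgroup.connectedComponentOfOne Aˣ

/-- The similarity orbit `orb(a) = {w a w⁻¹ : w ∈ G_𝟙(A)}`. -/
def similarityOrbit {A : Type*} [NormedRing A] (a : A) : Set A :=
  {x | ∃ w ∈ principalComponent A, x = (w : A) * a * ((w⁻¹ : Aˣ) : A)}

/-- The nonzero spectrum `σ'(x) = σ(x) \ {0}`. -/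
def nonzeroSpectrum {A : Type*} [NormedRing A] [NormedAlgebra ℂ A] (x : A) : Set ℂ :=
  spectrum ℂ x \ {0}

/-- The circle operation `a ∘ b = a + b - ab`. -/
def circleOp {A : Type*} [NormedRing A] (a b : A) : A :=
  a + b - a * b

/-!
If the orbits commute, then `(a r) ^ n = a ^ n r ^ n` and `(r + a) ^ n` is given by the binomial
formula for each `r = w b w⁻¹` in the orbit of `b`. Since `‖r ^ n‖ ≤ K ‖b‖ ^ n`, where only the
constant `K` depends on `w`, the spectra of `a r` lie in the disc of radius `‖a‖ ‖b‖` and those of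
`r + a` in the disc of radius `‖a‖ + ‖b‖` (`norm_le_of_mem_spectrum_mul`,
`norm_le_of_mem_spectrum_add`). So the unions of spectra are bounded and omit many points.

If some conjugates of `a` and `b` do not commute, semisimplicity provides an irreducible
representation `A ⧸ L`, with `L` a maximal left ideal, in which their commutator does not vanish.
Neither `a` nor `b` acts there as a scalar, so there are vectors `u`, `v` such that the pairs
`u, a u` and `v, b v` are linearly independent (`exists_isCoatom_linearIndependent`).
By Schur's lemma and Gelfand–Mazur the commutant of `A ⧸ L` is `ℂ`, so Jacobson's density theorem
prescribes the action of an element of `A` on finitely many independent vectors. Exponentiating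
elements that act as dilations or as square-zero maps shows that the principal component is
transitive on independent pairs (`exists_mem_principalComponent_smul_pair`). Hence for every
independent pair `p, q` some conjugate `r` of `b` maps `p` to `q`. The pair `a u, c u` makes `a u` an
eigenvector of `a r` with eigenvalue `c ≠ 0`, and the pair `u, c u - a u` makes `u` an eigenvector
of `r + a` with eigenvalue `c`. So every nonzero `c` occurs in the unions of spectra.

The difference is the sum with `-a`, and the circle operation is the product of `1 - a` and `1 - r`
up to the reflection `c ↦ 1 - c`, so these two cases reduce to the others.
-/

/-! ### Exponentials in the principal component -/

section Exponential

open NormedSpace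

variable {A : Type*} [NormedRing A] [NormedAlgebra ℂ A] [CompleteSpace A]

/-- Every exponential lies in the principal component: the units `exp (t x)` with `t` in `ℂ`
form a connected set that contains `1` and `exp x`. -/
theorem exists_mem_principalComponent_eq_exp (x : A) :
    ∃ w ∈ principalComponent A, (w : A) = exp x := by
  let _ : NormedAlgebra ℚ A := NormedAlgebra.restrictScalars ℚ ℂ A
  have hinv (y : A) : exp y * exp (-y) = 1 := by
    rw [← exp_add_of_commute (Commute.refl y).neg_right, add_neg_cancel, exp_zero]
  have hinv' (y : A) : exp (-y) * exp y = 1 := by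
    simpa using hinv (-y)
  let γ : ℂ → Aˣ := fun t ↦ ⟨exp (t • x), exp (-(t • x)), hinv _, hinv' _⟩
  have hγ : Continuous γ := by
    rw [Units.continuous_iff]
    constructor
    · exact exp_continuous.comp (continuous_id.smul continuous_const)
    · exact exp_continuous.comp (continuous_id.smul continuous_const).neg
  have h0 : γ 0 = 1 := Units.ext (by simp [γ])
  refine ⟨γ 1, ?_, by simp [γ]⟩
  have hconn : IsPreconnected (Set.range γ) := isPreconnected_range hγ
  exact hconn.subset_connectedComponent ⟨0, h0⟩ ⟨1, rfl⟩

variable {X : Type*} [NormedAddCommGroup X] [NormedSpace ℂ X] [Module A X] [IsScalarTower ℂ A X]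
  [ContinuousSMul A X]

theorem hasSum_exp_smul (x : A) (v : X) :
    HasSum (fun n : ℕ ↦ ((n.factorial : ℂ)⁻¹) • x ^ n • v) (exp x • v) := by
  have h := exp_series_hasSum_exp' (𝕂 := ℂ) x
  have h' := h.map ((LinearMap.toSpanSingleton A X v).toAddMonoidHom)
    (show Continuous fun y : A ↦ y • v from continuous_id.smul continuous_const)
  simpa [Function.comp_def] using h'

theorem exp_smul_of_smul_smul_eq_zero {x : A} {v : X} (h : x • x • v = 0) :
    exp x • v = v + x • v := by
  have h2 (n : ℕ) : x ^ (n + 2) • v = 0 := by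
    rw [pow_add, pow_two, mul_smul, mul_smul, h, smul_zero]
  refine (hasSum_exp_smul x v).unique ?_
  have := hasSum_sum_of_ne_finset_zero (L := .unconditional ℕ)
    (f := fun n : ℕ ↦ ((n.factorial : ℂ)⁻¹) • x ^ n • v) (s := Finset.range 2) (by
      intro n hn
      obtain ⟨m, rfl⟩ := Nat.exists_eq_add_of_le' (by simpa [Nat.lt_iff_add_one_le] using hn : 2 ≤ n)
      simp [h2])
  simpa [Finset.sum_range_succ] using this

theorem exp_smul_of_smul_eq_zero {x : A} {v : X} (h : x • v = 0) : exp x • v = v := by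
  simpa [h] using exp_smul_of_smul_smul_eq_zero (x := x) (v := v) (by simp [h])

theorem exp_smul_of_smul_eq_smul {x : A} {v : X} {c : ℂ} (h : x • v = c • v) :
    exp x • v = Complex.exp c • v := by
  have h2 (n : ℕ) : x ^ n • v = c ^ n • v := by
    induction n with
    | zero => simp
    | succ n ih => rw [pow_succ, mul_smul, h, smul_comm, ih, smul_smul, pow_succ']
  refine (hasSum_exp_smul x v).unique ?_
  have := (exp_series_hasSum_exp' (𝕂 := ℂ) c).smul_const v
  rw [← Complex.exp_eq_exp_ℂ] at this
  simpa [h2, smul_smul] using this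

end Exponential

/-! ### Density for irreducible representations -/

section Density

variable {A : Type*} [NormedRing A] [NormedAlgebra ℂ A] [CompleteSpace A]
  {X : Type*} [NormedAddCommGroup X] [NormedSpace ℂ X] [CompleteSpace X]
  [Module A X] [IsScalarTower ℂ A X] [ContinuousSMul A X] [IsSimpleModule A X]

/-- An endomorphism of an irreducible Banach module is continuous, because the module is, by the
open mapping theorem, a topological quotient of the algebra. -/
theorem continuous_moduleEnd (f : Module.End A X) : Continuous f := by
  obtain ⟨v, hv⟩ := @exists_ne X (IsSimpleModule.nontrivial A X) 0
  let p : A →L[ℂ] X :=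
    ⟨((LinearMap.toSpanSingleton A X v).restrictScalars ℂ),
      show Continuous fun y : A ↦ y • v from continuous_id.smul continuous_const⟩
  have hp : Function.Surjective p := IsSimpleModule.toSpanSingleton_surjective A hv
  refine (p.isQuotientMap hp).continuous_iff.2 ?_
  have : f ∘ p = fun y : A ↦ y • f v := by
    ext y
    exact map_smul f y v
  rw [this]
  exact continuous_id.smul continuous_const

/-- Schur's lemma for Banach algebras: a commuting operator has a spectral value `c` by
Gelfand–Mazur, and `f - c` is then not bijective, hence zero. -/
theorem exists_moduleEnd_eq_smul (f : Module.End A X) : ∃ c : ℂ, ∀ v, f v = c • v := by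
  have := IsSimpleModule.nontrivial A X
  let F : X →L[ℂ] X := ⟨f.restrictScalars ℂ, continuous_moduleEnd f⟩
  obtain ⟨c, hc⟩ := spectrum.nonempty F
  refine ⟨c, fun v ↦ ?_⟩
  let g : Module.End A X := c • LinearMap.id - f
  have hg (v : X) : g v = c • v - f v := rfl
  rcases g.bijective_or_eq_zero with hbij | h0
  · refine absurd ?_ hc
    rw [spectrum.mem_resolventSet_iff, ContinuousLinearMap.isUnit_iff_bijective]
    convert hbij using 1
    ext v
    simp [hg, F, Algebra.algebraMap_eq_smul_one]
    rfl
  · have := hg v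
    rw [h0, LinearMap.zero_apply] at this
    exact (sub_eq_zero.1 this.symm).symm

/-- Jacobson density over `ℂ`. -/
theorem exists_smul_eq_of_linearIndependent {ι : Type*} [Finite ι] {v : ι → X}
    (hv : LinearIndependent ℂ v) (u : ι → X) : ∃ x : A, ∀ i, x • v i = u i := by
  classical
  cases nonempty_fintype ι
  obtain ⟨g, hg'⟩ := LinearMap.exists_extend ((Module.Basis.span hv).constr ℂ u)
  have hg (i : ι) : g (v i) = u i := by
    have := LinearMap.congr_fun hg' (Module.Basis.span hv i)
    rwa [Module.Basis.constr_basis, LinearMap.comp_apply, Submodule.subtype_apply,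
      Module.Basis.span_apply] at this
  let G : Module.End (Module.End A X) X :=
    { toFun := g
      map_add' := map_add g
      map_smul' := fun f w ↦ by
        obtain ⟨c, hc⟩ := exists_moduleEnd_eq_smul f
        simp [Module.End.smul_def, hc] }
  obtain ⟨x, hx⟩ := jacobson_density (R := A) G (Finset.univ.image v)
  exact ⟨x, fun i ↦ by rw [← hx (v i) (by simp), ← hg i]; rfl⟩

/-- Elements of the principal component move one member of an independent pair to any position
that keeps the pair independent, and fix the other member. -/
theorem exists_mem_principalComponent_fix_left {e x y : X}
    (hx : LinearIndependent ℂ ![e, x]) (hy : LinearIndependent ℂ ![e, y]) :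
    ∃ w ∈ principalComponent A, (w : A) • e = e ∧ (w : A) • x = y := by
  by_cases hspan : y ∈ Submodule.span ℂ {e, x}
  · -- Inside the plane of `e` and `x`, a dilation of `x` is followed by a shear along `e`.
    obtain ⟨α, β, rfl⟩ := Submodule.mem_span_pair.1 hspan
    have hβ : β ≠ 0 := by
      rintro rfl
      rw [LinearIndependent.pair_iff] at hy
      simpa using hy (-α) 1 (by simp)
    obtain ⟨s, hs⟩ := exists_smul_eq_of_linearIndependent (A := A) hx ![0, Complex.log β • x]
    obtain ⟨t, ht⟩ := exists_smul_eq_of_linearIndependent (A := A) hx ![0, (β⁻¹ * α) • e]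
    have hs0 : s • e = 0 := hs 0
    have hs1 : s • x = Complex.log β • x := hs 1
    have ht0 : t • e = 0 := ht 0
    have ht1 : t • x = (β⁻¹ * α) • e := ht 1
    obtain ⟨w₁, hw₁, hw₁'⟩ := exists_mem_principalComponent_eq_exp s
    obtain ⟨w₂, hw₂, hw₂'⟩ := exists_mem_principalComponent_eq_exp t
    refine ⟨w₂ * w₁, mul_mem hw₂ hw₁, ?_, ?_⟩
    · rw [Units.val_mul, mul_smul, hw₁', hw₂', exp_smul_of_smul_eq_zero hs0,
        exp_smul_of_smul_eq_zero ht0]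
    · rw [Units.val_mul, mul_smul, hw₁', hw₂', exp_smul_of_smul_eq_smul hs1, Complex.exp_log hβ,
        smul_comm, exp_smul_of_smul_smul_eq_zero (by rw [ht1, smul_comm, ht0, smul_zero]), ht1,
        smul_add, smul_smul, mul_inv_cancel_left₀ hβ, add_comm]
  · -- Off that plane, `s` sends both `x` and `y` to `y - x`, so `s² x = 0` and `exp s` maps `x` to
    -- `x + (y - x) = y`.
    have hind : LinearIndependent ℂ ![y, e, x] := by
      refine linearIndependent_finCons.2 ⟨hx, ?_⟩
      simpa [Set.pair_comm] using hspan
    obtain ⟨s, hs⟩ := exists_smul_eq_of_linearIndependent (A := A) hind ![y - x, 0, y - x]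
    have hs0 : s • y = y - x := hs 0
    have hs1 : s • e = 0 := hs 1
    have hs2 : s • x = y - x := hs 2
    obtain ⟨w, hw, hw'⟩ := exists_mem_principalComponent_eq_exp s
    refine ⟨w, hw, ?_, ?_⟩
    · rw [hw', exp_smul_of_smul_eq_zero hs1]
    · rw [hw', exp_smul_of_smul_smul_eq_zero (by rw [hs2, smul_sub, hs0, hs2, sub_self]), hs2,
        add_sub_cancel]

/-- The principal component acts transitively on linearly independent pairs. -/
theorem exists_mem_principalComponent_smul_pair {x₁ x₂ y₁ y₂ : X}
    (hx : LinearIndependent ℂ ![x₁, x₂]) (hy : LinearIndependent ℂ ![y₁, y₂]) :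
    ∃ w ∈ principalComponent A, (w : A) • x₁ = y₁ ∧ (w : A) • x₂ = y₂ := by
  -- The pair passes through `(x₁, v)` and `(y₁, v)`, with `v` on neither of the lines spanned by
  -- `x₁` and `y₁`.
  obtain ⟨v, hv₁, hv₂⟩ : ∃ v, LinearIndependent ℂ ![x₁, v] ∧ LinearIndependent ℂ ![y₁, v] := by
    by_cases h1 : LinearIndependent ℂ ![y₁, x₂]
    · exact ⟨x₂, hx, h1⟩
    have hx₂ : x₂ ≠ 0 := hx.ne_zero 1
    have hy₁ : y₁ ≠ 0 := hy.ne_zero 0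
    rw [LinearIndependent.pair_iff' hy₁] at h1
    push Not at h1
    obtain ⟨c, rfl⟩ := h1
    have hc : c ≠ 0 := by
      rintro rfl
      simp at hx₂
    -- Here `y₁` and `x₂` are collinear, and `x₁`, `x₂` are not, so `x₁ + y₁` is on neither line.
    refine ⟨x₁ + y₁, ?_, ?_⟩
    · rw [LinearIndependent.pair_iff] at hx ⊢
      intro s t hst
      have := hx (s + t) (t * c⁻¹) (by
        rw [smul_smul, mul_assoc, inv_mul_cancel₀ hc, mul_one, ← hst]
        module)
      have ht : t = 0 := by simpa [hc] using this.2
      exact ⟨by simpa [ht] using this.1, ht⟩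
    · rw [LinearIndependent.pair_iff] at hx ⊢
      intro s t hst
      have := hx t ((s + t) * c⁻¹) (by
        rw [smul_smul, mul_assoc, inv_mul_cancel₀ hc, mul_one, ← hst]
        module)
      have hs : s + t = 0 := by simpa [hc] using this.2
      exact ⟨by simpa [this.1] using hs, this.1⟩
  obtain ⟨w₁, hw₁, h₁, h₁'⟩ := exists_mem_principalComponent_fix_left (A := A) hx hv₁
  obtain ⟨w₂, hw₂, h₂, h₂'⟩ := exists_mem_principalComponent_fix_left (A := A)
    (LinearIndependent.pair_symm_iff.1 hv₁) (LinearIndependent.pair_symm_iff.1 hv₂)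
  obtain ⟨w₃, hw₃, h₃, h₃'⟩ := exists_mem_principalComponent_fix_left (A := A) hv₂ hy
  refine ⟨w₃ * w₂ * w₁, mul_mem (mul_mem hw₃ hw₂) hw₁, ?_, ?_⟩
  · simp only [Units.val_mul, mul_smul, h₁, h₂', h₃]
  · simp only [Units.val_mul, mul_smul, h₁', h₂, h₃']

end Density

/-! ### Similarity orbits and growth of powers -/

section NormedRing

variable {A : Type*} [NormedRing A]

theorem norm_pow_le_norm_one_mul (x : A) (n : ℕ) : ‖x ^ n‖ ≤ ‖(1 : A)‖ * ‖x‖ ^ n := by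
  induction n with
  | zero => simp
  | succ n ih =>
    rw [pow_succ, pow_succ, ← mul_assoc]
    exact (norm_mul_le _ _).trans (by gcongr)

theorem isClosed_of_isCoatom [CompleteSpace A] {L : Submodule A A} (hL : IsCoatom L) : IsClosed (L : Set A) :=
  have : Ideal.IsMaximal L := ⟨hL⟩
  Ideal.IsMaximal.isClosed (I := L)

theorem self_mem_similarityOrbit (a : A) : a ∈ similarityOrbit a :=
  ⟨1, one_mem _, by simp⟩

/-- The powers of a conjugate of `b` grow like those of `b`, up to a constant. -/
theorem exists_norm_pow_le_of_mem_similarityOrbit {b r : A} (hr : r ∈ similarityOrbit b) :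
    ∃ K : ℝ, 0 ≤ K ∧ ∀ n : ℕ, ‖r ^ n‖ ≤ K * ‖b‖ ^ n := by
  obtain ⟨w, -, rfl⟩ := hr
  refine ⟨‖(w : A)‖ * ‖(1 : A)‖ * ‖((w⁻¹ : Aˣ) : A)‖, by positivity, fun n ↦ ?_⟩
  rw [Units.conj_pow]
  calc _ ≤ ‖(w : A)‖ * ‖b ^ n‖ * ‖((w⁻¹ : Aˣ) : A)‖ := norm_mul₃_le
    _ ≤ ‖(w : A)‖ * (‖(1 : A)‖ * ‖b‖ ^ n) * ‖((w⁻¹ : Aˣ) : A)‖ := by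
      gcongr
      exact norm_pow_le_norm_one_mul b n
    _ = _ := by ring

theorem mem_similarityOrbit_neg {a x : A} :
    x ∈ similarityOrbit (-a) ↔ -x ∈ similarityOrbit a := by
  simp only [similarityOrbit, Set.mem_ofPred_eq, mul_neg, neg_mul, neg_eq_iff_eq_neg]

theorem mem_similarityOrbit_one_sub {a x : A} :
    x ∈ similarityOrbit (1 - a) ↔ 1 - x ∈ similarityOrbit a := by
  simp only [similarityOrbit, Set.mem_ofPred_eq, mul_sub, sub_mul, mul_one, Units.mul_inv]
  refine exists_congr fun w ↦ and_congr_right fun _ ↦ ⟨fun h ↦ ?_, fun h ↦ ?_⟩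
  · rw [h, sub_sub_cancel]
  · rw [← h, sub_sub_cancel]

/-- Replacing `a` by `-a` does not change whether the orbits commute. -/
theorem orbits_commute_neg_left (a b : A) :
    (∀ x ∈ similarityOrbit (-a), ∀ y ∈ similarityOrbit b, Commute x y) ↔
      ∀ x ∈ similarityOrbit a, ∀ y ∈ similarityOrbit b, Commute x y := by
  refine ⟨fun h x hx y hy ↦ ?_, fun h x hx y hy ↦ ?_⟩
  · exact Commute.neg_left_iff.1 (h (-x) (mem_similarityOrbit_neg.2 (by rwa [neg_neg])) y hy)
  · exact Commute.neg_left_iff.1 (h (-x) (mem_similarityOrbit_neg.1 hx) y hy)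

theorem commute_one_sub_one_sub {x y : A} (h : Commute (1 - x) (1 - y)) : Commute x y := by
  have := ((Commute.one_left (1 - y)).sub_left h)
  rw [sub_sub_cancel] at this
  simpa using (Commute.one_right x).sub_right this

/-- Replacing both elements by their differences from `1` does not change whether the orbits
commute. -/
theorem orbits_commute_one_sub (a b : A) :
    (∀ x ∈ similarityOrbit (1 - a), ∀ y ∈ similarityOrbit (1 - b), Commute x y) ↔
      ∀ x ∈ similarityOrbit a, ∀ y ∈ similarityOrbit b, Commute x y := by
  refine ⟨fun h x hx y hy ↦ commute_one_sub_one_sub (h _ ?_ _ ?_),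
    fun h x hx y hy ↦ commute_one_sub_one_sub
      (h _ (mem_similarityOrbit_one_sub.1 hx) _ (mem_similarityOrbit_one_sub.1 hy))⟩
  · exact mem_similarityOrbit_one_sub.2 (by rwa [sub_sub_cancel])
  · exact mem_similarityOrbit_one_sub.2 (by rwa [sub_sub_cancel])

end NormedRing

/-! ### Spectral values of products and sums over an orbit -/

section Spectrum

variable {A : Type*} [NormedRing A] [NormedAlgebra ℂ A]

theorem mem_spectrum_of_smul_eq_smul {X : Type*} [AddCommGroup X] [Module ℂ X] [Module A X]
    [IsScalarTower ℂ A X] {x : A} {v : X} (hv : v ≠ 0) {c : ℂ} (h : x • v = c • v) :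
    c ∈ spectrum ℂ x := by
  intro hunit
  rw [resolventSet, Set.mem_ofPred_eq] at hunit
  refine hv ((hunit.smul_eq_zero (x := v)).1 ?_)
  rw [sub_smul, algebraMap_smul, h, sub_self]

/-- In a semisimple algebra, if some conjugates of `a` and `b` do not commute, then there is an
irreducible representation in which neither `a` nor `b` acts as a scalar, so each of them has a
vector that it moves off its line. -/
theorem exists_isCoatom_linearIndependent (hA : Ring.jacobson A = ⊥) {a b : A}
    (h : ¬ ∀ x ∈ similarityOrbit a, ∀ y ∈ similarityOrbit b, Commute x y) :
    ∃ L : Submodule A A, IsCoatom L ∧ (∃ u : A ⧸ L, LinearIndependent ℂ ![u, a • u]) ∧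
      ∃ v : A ⧸ L, LinearIndependent ℂ ![v, b • v] := by
  push Not at h
  obtain ⟨_, ⟨g, -, rfl⟩, _, ⟨k, -, rfl⟩, hcomm⟩ := h
  set x := (g : A) * a * ((g⁻¹ : Aˣ) : A)
  set y := (k : A) * b * ((k⁻¹ : Aˣ) : A)
  have hne : x * y - y * x ≠ 0 := fun h0 ↦ hcomm (sub_eq_zero.1 h0)
  obtain ⟨L, hL, hxy⟩ : ∃ L : Submodule A A, IsCoatom L ∧ x * y - y * x ∉ L := by
    by_contra! hall
    refine hne ?_
    have : x * y - y * x ∈ Ring.jacobson A := Submodule.mem_sInf.2 hall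
    simpa [hA] using this
  -- A conjugate of an element that acts as a scalar acts as the same scalar.
  have hconj (c : A) (w : Aˣ) (hc : ¬ ∃ u : A ⧸ L, LinearIndependent ℂ ![u, c • u]) :
      ∃ z : ℂ, ∀ u : A ⧸ L, ((w : A) * c * ((w⁻¹ : Aˣ) : A)) • u = z • u := by
    push Not at hc
    let f : (A ⧸ L) →ₗ[ℂ] (A ⧸ L) := Algebra.lsmul ℂ ℂ (A ⧸ L) c
    obtain ⟨z, hz⟩ := LinearMap.exists_eq_smul_id_of_forall_notLinearIndependent (f := f) hc
    have hz' (u : A ⧸ L) : c • u = z • u := LinearMap.congr_fun hz u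
    refine ⟨z, fun u ↦ ?_⟩
    rw [mul_smul, mul_smul, hz', smul_comm, smul_smul, Units.mul_inv, one_smul]
  have hL' : (x * y - y * x) • (Submodule.Quotient.mk 1 : A ⧸ L) ≠ 0 := by
    rw [← Submodule.Quotient.mk_smul, Ne, Submodule.Quotient.mk_eq_zero]
    simpa using hxy
  refine ⟨L, hL, ?_, ?_⟩
  · by_contra hc
    obtain ⟨z, hz⟩ := hconj a g hc
    refine hL' ?_
    rw [sub_smul, mul_smul x y, mul_smul y x, hz, hz, smul_comm y z, sub_self]
  · by_contra hc
    obtain ⟨z, hz⟩ := hconj b k hc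
    refine hL' ?_
    rw [sub_smul, mul_smul x y, mul_smul y x, hz, hz, smul_comm x z, sub_self]

variable [CompleteSpace A]

/-- In the irreducible representation of `exists_isCoatom_linearIndependent`, transitivity on pairs
carries the pair `v, b v` to any independent pair `p, q`; the corresponding conjugate of `b` then
maps `p` to `q`. -/
theorem exists_module_orbit_transitive (hA : Ring.jacobson A = ⊥) {a b : A}
    (h : ¬ ∀ x ∈ similarityOrbit a, ∀ y ∈ similarityOrbit b, Commute x y) :
    ∃ L : Submodule A A, (∃ u : A ⧸ L, LinearIndependent ℂ ![u, a • u]) ∧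
      ∀ p q : A ⧸ L, LinearIndependent ℂ ![p, q] → ∃ r ∈ similarityOrbit b, r • p = q := by
  obtain ⟨L, hL, hu, v, hv⟩ := exists_isCoatom_linearIndependent hA h
  have : IsClosed (L : Set A) := isClosed_of_isCoatom hL
  have : IsSimpleModule A (A ⧸ L) := isSimpleModule_iff_isCoatom.2 hL
  refine ⟨L, hu, fun p q hpq ↦ ?_⟩
  obtain ⟨w, hw, h₁, h₂⟩ := exists_mem_principalComponent_smul_pair (A := A) hv hpq
  refine ⟨_, ⟨w, hw, rfl⟩, ?_⟩
  rw [mul_smul, mul_smul, ← h₁, smul_smul _ _ v, Units.inv_mul, one_smul, h₂]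

/-- Without commuting orbits, the products `a r` attain every nonzero spectral value. -/
theorem exists_mem_spectrum_mul (hA : Ring.jacobson A = ⊥) {a b : A}
    (h : ¬ ∀ x ∈ similarityOrbit a, ∀ y ∈ similarityOrbit b, Commute x y) {c : ℂ} (hc : c ≠ 0) :
    ∃ r ∈ similarityOrbit b, c ∈ spectrum ℂ (a * r) := by
  obtain ⟨L, ⟨u, hu⟩, hb⟩ := exists_module_orbit_transitive hA h
  -- `r` maps `a u` to `c u`, so `a u` is an eigenvector of `a r`.
  obtain ⟨r, hr, hru⟩ := hb (a • u) (c • u) (by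
    rw [LinearIndependent.pair_symm_iff, LinearIndependent.pair_iff]
    intro s t hst
    have := LinearIndependent.pair_iff.1 hu (s * c) t (by rw [mul_smul, hst])
    simpa [hc] using this)
  refine ⟨r, hr, mem_spectrum_of_smul_eq_smul (v := a • u) (hu.ne_zero 1) ?_⟩
  rw [mul_smul, hru, smul_comm a c u]

/-- Without commuting orbits, the sums `r + a` attain every spectral value, including `0`. -/
theorem exists_mem_spectrum_add (hA : Ring.jacobson A = ⊥) {a b : A}
    (h : ¬ ∀ x ∈ similarityOrbit a, ∀ y ∈ similarityOrbit b, Commute x y) (c : ℂ) :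
    ∃ r ∈ similarityOrbit b, c ∈ spectrum ℂ (r + a) := by
  obtain ⟨L, ⟨u, hu⟩, hb⟩ := exists_module_orbit_transitive hA h
  -- `r` maps `u` to `c u - a u`, so `u` is an eigenvector of `r + a`.
  obtain ⟨r, hr, hru⟩ := hb u (c • u - a • u) (by
    rw [LinearIndependent.pair_iff]
    intro s t hst
    have := LinearIndependent.pair_iff.1 hu (s + t * c) (-t) (by
      rw [← hst, add_smul, neg_smul, mul_smul, smul_sub]
      abel)
    have ht : t = 0 := by simpa using this.2
    exact ⟨by simpa [ht] using this.1, ht⟩)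
  refine ⟨r, hr, mem_spectrum_of_smul_eq_smul (v := u) (hu.ne_zero 0) ?_⟩
  rw [add_smul, hru, sub_add_cancel]

/-- A constant factor in a bound on the powers does not affect the bound on the spectrum. -/
theorem norm_le_of_mem_spectrum_of_norm_pow_le {x : A} {K M : ℝ} (hM : 0 ≤ M)
    (h : ∀ n : ℕ, ‖x ^ n‖ ≤ K * M ^ n) {c : ℂ} (hc : c ∈ spectrum ℂ x) : ‖c‖ ≤ M := by
  have hpow (n : ℕ) : ‖c‖ ^ n ≤ K * ‖(1 : A)‖ * M ^ n := by
    have hmem : c ^ n ∈ spectrum ℂ (x ^ n) := spectrum.pow_mem_pow x n hc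
    calc ‖c‖ ^ n = ‖c ^ n‖ := (norm_pow c n).symm
      _ ≤ ‖x ^ n‖ * ‖(1 : A)‖ := spectrum.norm_le_norm_mul_of_mem hmem
      _ ≤ K * M ^ n * ‖(1 : A)‖ := by gcongr; exact h n
      _ = _ := by ring
  by_contra! hlt
  rcases hM.eq_or_lt with rfl | hM0
  · have := hpow 1
    simp at this
    exact hlt.ne' (by simp [this])
  · obtain ⟨n, hn⟩ := pow_unbounded_of_one_lt (K * ‖(1 : A)‖) ((one_lt_div hM0).2 hlt)
    rw [div_pow, lt_div_iff₀ (by positivity)] at hn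
    exact absurd (hpow n) (not_le.2 hn)

/-- The bound is the same for all conjugates `r` of `b`. -/
theorem norm_le_of_mem_spectrum_mul {a b r : A} (hr : r ∈ similarityOrbit b) (hcomm : Commute a r)
    {c : ℂ} (hc : c ∈ spectrum ℂ (a * r)) : ‖c‖ ≤ ‖a‖ * ‖b‖ := by
  obtain ⟨K, hK, hr'⟩ := exists_norm_pow_le_of_mem_similarityOrbit hr
  refine norm_le_of_mem_spectrum_of_norm_pow_le (K := ‖(1 : A)‖ * K) (by positivity)
    (fun n ↦ ?_) hc
  rw [hcomm.mul_pow]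
  calc _ ≤ ‖a ^ n‖ * ‖r ^ n‖ := norm_mul_le _ _
    _ ≤ (‖(1 : A)‖ * ‖a‖ ^ n) * (K * ‖b‖ ^ n) := by
      gcongr
      · exact norm_pow_le_norm_one_mul a n
      · exact hr' n
    _ = _ := by rw [mul_pow]; ring

/-- The bound is the same for all conjugates `r` of `b`. -/
theorem norm_le_of_mem_spectrum_add {a b r : A} (hr : r ∈ similarityOrbit b) (hcomm : Commute a r)
    {c : ℂ} (hc : c ∈ spectrum ℂ (r + a)) : ‖c‖ ≤ ‖b‖ + ‖a‖ := by
  obtain ⟨K, hK, hr'⟩ := exists_norm_pow_le_of_mem_similarityOrbit hr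
  refine norm_le_of_mem_spectrum_of_norm_pow_le (K := ‖(1 : A)‖ * K) (by positivity)
    (fun n ↦ ?_) hc
  rw [hcomm.symm.add_pow', (Commute.all ‖b‖ ‖a‖).add_pow']
  refine (norm_sum_le _ _).trans ?_
  rw [Finset.mul_sum]
  refine Finset.sum_le_sum fun m _ ↦ ?_
  calc _ ≤ (n.choose m.1 : ℝ) * ‖r ^ m.1 * a ^ m.2‖ := by
        simpa using norm_nsmul_le (n := n.choose m.1) (a := r ^ m.1 * a ^ m.2)
    _ ≤ (n.choose m.1 : ℝ) * (‖r ^ m.1‖ * ‖a ^ m.2‖) := by gcongr; exact norm_mul_le _ _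
    _ ≤ (n.choose m.1 : ℝ) * ((K * ‖b‖ ^ m.1) * (‖(1 : A)‖ * ‖a‖ ^ m.2)) := by
      gcongr
      · exact hr' _
      · exact norm_pow_le_norm_one_mul a _
    _ = _ := by rw [nsmul_eq_mul]; ring

end Spectrum

/-! ### Omitted values and commuting orbits -/

section Main

variable {A : Type*} [NormedRing A] [NormedAlgebra ℂ A]

/-- The circle operation is multiplication seen through `x ↦ 1 - x`:
`(1 - a) (1 - r) = 1 - a ∘ r`. -/
theorem mem_spectrum_circleOp_iff {a r : A} {c : ℂ} :
    c ∈ spectrum ℂ (circleOp a r) ↔ 1 - c ∈ spectrum ℂ ((1 - a) * (1 - r)) := by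
  have h : (1 - a) * (1 - r) = algebraMap ℂ A 1 - circleOp a r := by
    rw [circleOp, map_one]
    noncomm_ring
  rw [h, ← spectrum.singleton_sub_eq, Set.singleton_sub, Set.mem_image]
  simp

/-- A bounded set of complex numbers misses a point other than `0` and `1`. -/
theorem exists_notMem_of_norm_le {S : Set ℂ} {M : ℝ} (h : ∀ c ∈ S, ‖c‖ ≤ M) :
    ∃ c : ℂ, c ≠ 0 ∧ c ≠ 1 ∧ c ∉ S := by
  have hpos : 0 < |M| + 2 := by positivity
  refine ⟨((|M| + 2 : ℝ) : ℂ), by exact_mod_cast hpos.ne', ?_, fun hc ↦ ?_⟩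
  · intro h1
    have : |M| + 2 = 1 := by exact_mod_cast h1
    linarith [abs_nonneg M]
  · have := h _ hc
    rw [Complex.norm_real, Real.norm_of_nonneg hpos.le] at this
    linarith [le_abs_self M]

variable [CompleteSpace A]

theorem orbits_commute_iff_mul (hA : Ring.jacobson A = ⊥) (a b : A) :
    (∀ x ∈ similarityOrbit a, ∀ y ∈ similarityOrbit b, Commute x y) ↔
      (⋃ r ∈ similarityOrbit b, nonzeroSpectrum (a * r)) ≠ ({0}ᶜ : Set ℂ) := by
  refine ⟨fun h heq ↦ ?_, fun hne ↦ ?_⟩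
  · obtain ⟨c, hc0, -, hc⟩ := exists_notMem_of_norm_le (S := {0}ᶜ) (M := ‖a‖ * ‖b‖) (by
      rw [← heq]
      intro c hc
      simp only [Set.mem_iUnion] at hc
      obtain ⟨r, hr, hc, -⟩ := hc
      exact norm_le_of_mem_spectrum_mul hr (h a (self_mem_similarityOrbit a) r hr) hc)
    exact hc hc0
  · contrapose! hne
    refine Set.Subset.antisymm (Set.iUnion₂_subset fun r _ c hc ↦ hc.2) fun c hc ↦ ?_
    obtain ⟨r, hr, hcr⟩ := exists_mem_spectrum_mul hA (by push Not; exact hne) hc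
    exact Set.mem_biUnion hr ⟨hcr, hc⟩

theorem orbits_commute_iff_add (hA : Ring.jacobson A = ⊥) (a b : A) :
    (∀ x ∈ similarityOrbit a, ∀ y ∈ similarityOrbit b, Commute x y) ↔
      (⋃ r ∈ similarityOrbit b, nonzeroSpectrum (r + a)) ≠ ({0}ᶜ : Set ℂ) := by
  refine ⟨fun h heq ↦ ?_, fun hne ↦ ?_⟩
  · obtain ⟨c, hc0, -, hc⟩ := exists_notMem_of_norm_le (S := {0}ᶜ) (M := ‖b‖ + ‖a‖) (by
      rw [← heq]
      intro c hc
      simp only [Set.mem_iUnion] at hc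
      obtain ⟨r, hr, hc, -⟩ := hc
      exact norm_le_of_mem_spectrum_add hr (h a (self_mem_similarityOrbit a) r hr) hc)
    exact hc hc0
  · contrapose! hne
    refine Set.Subset.antisymm (Set.iUnion₂_subset fun r _ c hc ↦ hc.2) fun c hc ↦ ?_
    obtain ⟨r, hr, hcr⟩ := exists_mem_spectrum_add hA (by push Not; exact hne) c
    exact Set.mem_biUnion hr ⟨hcr, hc⟩

theorem orbits_commute_iff_circleOp (hA : Ring.jacobson A = ⊥) (a b : A) :
    (∀ x ∈ similarityOrbit a, ∀ y ∈ similarityOrbit b, Commute x y) ↔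
      (⋃ r ∈ similarityOrbit b, (nonzeroSpectrum (circleOp a r) \ {1})) ≠
        ({0, 1}ᶜ : Set ℂ) := by
  refine ⟨fun h heq ↦ ?_, fun hne ↦ ?_⟩
  · obtain ⟨c, hc0, hc1, hc⟩ := exists_notMem_of_norm_le (S := {0, 1}ᶜ)
      (M := ‖(1 : ℂ)‖ + ‖1 - a‖ * ‖1 - b‖) (by
      rw [← heq]
      intro c hc
      simp only [Set.mem_iUnion] at hc
      obtain ⟨r, hr, ⟨hc, -⟩, -⟩ := hc
      have hr' : 1 - r ∈ similarityOrbit (1 - b) :=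
        mem_similarityOrbit_one_sub.2 (by rwa [sub_sub_cancel])
      have hcomm : Commute (1 - a) (1 - r) :=
        (orbits_commute_one_sub a b).2 h _ (self_mem_similarityOrbit _) _ hr'
      have := norm_le_of_mem_spectrum_mul hr' hcomm (mem_spectrum_circleOp_iff.1 hc)
      calc ‖c‖ = ‖1 - (1 - c)‖ := by rw [sub_sub_cancel]
        _ ≤ _ := (norm_sub_le _ _).trans (by gcongr))
    exact hc (by simp [hc0, hc1])
  · contrapose! hne
    refine Set.Subset.antisymm (Set.iUnion₂_subset fun r _ c hc ↦ ?_) fun c hc ↦ ?_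
    · have h0 : c ≠ 0 := hc.1.2
      have h1 : c ≠ 1 := hc.2
      simp [h0, h1]
    · have hc' : c ≠ 0 ∧ c ≠ 1 := by simpa using hc
      have hnc : ¬ ∀ x ∈ similarityOrbit (1 - a), ∀ y ∈ similarityOrbit (1 - b), Commute x y := by
        rw [orbits_commute_one_sub]
        push Not
        exact hne
      obtain ⟨s, hs, hcs⟩ := exists_mem_spectrum_mul hA hnc (sub_ne_zero.2 hc'.2.symm)
      refine Set.mem_biUnion (mem_similarityOrbit_one_sub.1 hs) ⟨⟨?_, hc'.1⟩, hc'.2⟩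
      rwa [mem_spectrum_circleOp_iff, sub_sub_cancel]

end Main

theorem mainTheorem1 {A : Type*} [NormedRing A] [NormedAlgebra ℂ A] [CompleteSpace A]
    (hA : Ring.jacobson A = ⊥) (a b : A) :
    ((∀ x ∈ similarityOrbit a, ∀ y ∈ similarityOrbit b, Commute x y) ↔
      (⋃ r ∈ similarityOrbit b, nonzeroSpectrum (a * r)) ≠ ({0}ᶜ : Set ℂ)) ∧
    ((∀ x ∈ similarityOrbit a, ∀ y ∈ similarityOrbit b, Commute x y) ↔
      (⋃ r ∈ similarityOrbit b, nonzeroSpectrum (r + a)) ≠ ({0}ᶜ : Set ℂ)) ∧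
    ((∀ x ∈ similarityOrbit a, ∀ y ∈ similarityOrbit b, Commute x y) ↔
      (⋃ r ∈ similarityOrbit b, nonzeroSpectrum (r - a)) ≠ ({0}ᶜ : Set ℂ)) ∧
    ((∀ x ∈ similarityOrbit a, ∀ y ∈ similarityOrbit b, Commute x y) ↔
      (⋃ r ∈ similarityOrbit b, (nonzeroSpectrum (circleOp a r) \ {1})) ≠
        ({0, 1}ᶜ : Set ℂ)) := by
  refine ⟨orbits_commute_iff_mul hA a b, orbits_commute_iff_add hA a b, ?_,
    orbits_commute_iff_circleOp hA a b⟩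
  simp only [sub_eq_add_neg]
  rw [← orbits_commute_neg_left, orbits_commute_iff_add hA]
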